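/- **Theorem 1.** There exist absolute constants $C_\varepsilon, C_e>0$ such that the following holds for all positive integers $m,n$, all integers $r\ge 2$, all real $p\ge 1$ with $p<\sqrt{r-1}$ if $r>2$ and $p=1$ if $r=2$, and all real $\varepsilon>0$. For a matrix $A$, let $\|A\|$ be its spectral norm, $\sigma_r(A)$ its $r$-th largest singular value, and $\|A\|_{1,2}$ the maximum Euclidean norm of its columns. Let $q=\sqrt{r-p^2}$, and let $$X = W^\#(H^\#)^\top + N^\# \in\mathbb R^{m\times n},$$ where $H^\#\in\mathbb R^{n\times r}$ is row stochastic (entrywise nonnegative with rows summing to $1$) and $p$-SSC, that is, $$\Big\{x\in\mathbb R^r : x\ge 0,\ \textstyle\sum_i x_i\ge p\,\|x\|_2\Big\}\subseteq \{(H^\#)^\top h : h\in\mathbb R^n,\ h\ge 0\},$$ where $W^\#\in\mathbb R^{m\times r}$ has rank $r$, and where $N^\#\in\mathbb R^{m\times n}$ satisfies $\|N^\#\|_{1,2}\le\varepsilon$. Suppose that $$\varepsilon\le C_\varepsilon\,\big(\min\{q,\sqrt2\}-1\big)^2\,\frac{\sigma_r(W^\#)}{r^{9/2}}\,\frac{q^2}{p^2}.$$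 Then every optimal solution $(W^*,H^*)$ of $$\min_{W\in\mathbb R^{m\times r},\,H\in\mathbb R^{n\times r}}\det(W^\top W)\quad\text{such that}\quad \|X-WH^\top\|_{1,2}\le\varepsilon,\ H \text{ row stochastic},$$ satisfies $$\min_{\Pi}\|W^\#-W^*\Pi\|_{1,2}\le C_e\,\|W^\#\|\sqrt{\frac{\varepsilon}{\min\{q^2-1,1\}}\,\frac{r^{7/2}}{\sigma_r(W^\#)}\,\frac{p^2}{q^2}},$$ where the minimum is over all $r\times r$ permutation matrices $\Pi$. -/

import Mathlib

namespace MinVolNMF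

/-- `‖A‖_{1,2}`: the maximum Euclidean norm of the columns of `A`. -/
noncomputable def normOneTwo {m n : ℕ} (A : Matrix (Fin m) (Fin n) ℝ) : ℝ :=
  ⨆ j : Fin n, ‖WithLp.toLp 2 (fun i => A i j)‖

/-- `‖A‖`: the spectral norm of `A`, that is, the operator norm of `x ↦ A x` for the
Euclidean norms. -/
noncomputable def spectralNorm {m n : ℕ} (A : Matrix (Fin m) (Fin n) ℝ) : ℝ :=
  ‖LinearMap.toContinuousLinearMap (Matrix.toEuclideanLin A)‖

/-- `σ_k(A)`: the `k`-th largest singular value of `A`, counted from `k = 1`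
(Mathlib counts from `0`). -/
noncomputable def singularValue {m n : ℕ} (A : Matrix (Fin m) (Fin n) ℝ) (k : ℕ) : ℝ :=
  (Matrix.toEuclideanLin A).singularValues (k - 1)

/-- `H` is entrywise nonnegative and each of its rows sums to one (`H ≥ 0`, `H e = e`). -/
def IsRowStochastic {n r : ℕ} (H : Matrix (Fin n) (Fin r) ℝ) : Prop :=
  (∀ i j, 0 ≤ H i j) ∧ ∀ i, ∑ j, H i j = 1

/-- `cone(A) = {A h | h ≥ 0}`: the cone generated by the columns of `A`. -/
def cone {r n : ℕ} (A : Matrix (Fin r) (Fin n) ℝ) : Set (Fin r → ℝ) :=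
  {x | ∃ h : Fin n → ℝ, (∀ i, 0 ≤ h i) ∧ x = A.mulVec h}

/-- `C_p = {x ∈ ℝ^r_+ | eᵀ x ≥ p ‖x‖}`, with the Euclidean norm of `x`. -/
def coneC (r : ℕ) (p : ℝ) : Set (Fin r → ℝ) :=
  {x | (∀ i, 0 ≤ x i) ∧ p * ‖WithLp.toLp 2 x‖ ≤ ∑ i, x i}

/-- The expanded sufficiently scattered condition (`p`-SSC): `C_p ⊆ cone(Hᵀ)`. -/
def IsPSSC {n r : ℕ} (p : ℝ) (H : Matrix (Fin n) (Fin r) ℝ) : Prop :=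
  coneC r p ⊆ cone H.transpose

/-- `vol(W) = det(Wᵀ W)`. -/
noncomputable def vol {m r : ℕ} (W : Matrix (Fin m) (Fin r) ℝ) : ℝ :=
  (W.transpose * W).det

/-- Feasibility of `(W, H)` for the `ε`-approximate min-vol NMF problem with data `X`:
`‖X - W Hᵀ‖_{1,2} ≤ ε`, `H e = e` and `H ≥ 0`. -/
def IsFeasible {m n r : ℕ} (X : Matrix (Fin m) (Fin n) ℝ) (ε : ℝ)
    (W : Matrix (Fin m) (Fin r) ℝ) (H : Matrix (Fin n) (Fin r) ℝ) : Prop :=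
  normOneTwo (X - W * H.transpose) ≤ ε ∧ IsRowStochastic H

/-- `(W, H)` is an optimal solution of the `ε`-approximate min-vol NMF problem: it is feasible
and minimizes `det(Wᵀ W)` among all feasible pairs. -/
def IsOptimal {m n r : ℕ} (X : Matrix (Fin m) (Fin n) ℝ) (ε : ℝ)
    (W : Matrix (Fin m) (Fin r) ℝ) (H : Matrix (Fin n) (Fin r) ℝ) : Prop :=
  IsFeasible X ε W H ∧
    ∀ (W' : Matrix (Fin m) (Fin r) ℝ) (H' : Matrix (Fin n) (Fin r) ℝ),
      IsFeasible X ε W' H' → vol W ≤ vol W'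

end MinVolNMF

/-! Each `W₀ y`, with `y` in the slice of `C_p` by the unit simplex, lies within `2ε` of some `W z`
with `z` in the simplex (`exists_close_of_feasible`). Let `B` be the pseudo-inverse of `W₀` times
`W`. Then `y` is within `δ = 2ε/σ_r(W₀)` of `B z`; this forces `B` to be invertible, and `A = B⁻¹`
sends the slice almost into the simplex. Moreover `W A = W₀ + T` with `T` orthogonal to the columns
of `W₀`, so the Gram determinant of `W A` is at least that of `W₀`. Since `vol W ≤ vol W₀`, this
gives `|det A| ≥ 1`.

The rows of `A` almost lie in the dual of `C_p`, whose elements split into a nonnegative vector plus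
a vector of a circular cone (`exists_add_of_dual_coneC`). On both pieces the entry sum dominates the
Euclidean norm. The entries of `A` sum to about `r`, while Hadamard's inequality and AM-GM force the
row norms to sum to at least `r`. Hence every row has a small defect (sum minus norm), and a small
defect means concentration on one coordinate (`exists_peak`). Column sums near one make these
coordinates a permutation (`exists_perm_close`).

The resulting error is linear in `ε`, of order `‖W₀‖ r² δ / (min{q,√2} - 1)`. The smallness of `ε`
converts it into the square-root bound. -/

namespace MinVolNMF
open Matrix

/-! ### Euclidean norms of tuples and columns -/

/-- The Euclidean norm of a real tuple. -/
noncomputable def l2 {n : ℕ} (x : Fin n → ℝ) : ℝ := ‖WithLp.toLp 2 x‖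

lemma l2_nonneg {n : ℕ} (x : Fin n → ℝ) : 0 ≤ l2 x := norm_nonneg _

lemma l2_sq {n : ℕ} (x : Fin n → ℝ) : l2 x ^ 2 = ∑ i, x i ^ 2 := by
  simp [l2, EuclideanSpace.norm_sq_eq]

lemma l2_sq_dot {n : ℕ} (x : Fin n → ℝ) : l2 x ^ 2 = x ⬝ᵥ x := by
  rw [l2_sq]; simp only [dotProduct, sq]

lemma l2_add_le {n : ℕ} (x y : Fin n → ℝ) : l2 (x + y) ≤ l2 x + l2 y :=
  norm_add_le (WithLp.toLp 2 x) (WithLp.toLp 2 y)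

lemma l2_sub_le {n : ℕ} (x y : Fin n → ℝ) : l2 (x - y) ≤ l2 x + l2 y :=
  norm_sub_le (WithLp.toLp 2 x) (WithLp.toLp 2 y)

lemma l2_smul {n : ℕ} (c : ℝ) (x : Fin n → ℝ) : l2 (c • x) = |c| * l2 x :=
  norm_smul c (WithLp.toLp 2 x)

lemma l2_zero {n : ℕ} : l2 (0 : Fin n → ℝ) = 0 :=
  norm_zero (E := EuclideanSpace ℝ (Fin n))

lemma l2_sum_le {ι : Type*} {n : ℕ} (s : Finset ι) (f : ι → Fin n → ℝ) :
    l2 (∑ i ∈ s, f i) ≤ ∑ i ∈ s, l2 (f i) :=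
  Finset.le_sum_of_subadditive l2 l2_zero.le l2_add_le s f

lemma eq_zero_of_l2_eq_zero {n : ℕ} {x : Fin n → ℝ} (h : l2 x = 0) : x = 0 := by
  have := norm_eq_zero.1 h
  simpa using this

lemma abs_dot_le {n : ℕ} (x y : Fin n → ℝ) : |x ⬝ᵥ y| ≤ l2 x * l2 y := by
  have := abs_real_inner_le_norm (WithLp.toLp 2 y) (WithLp.toLp 2 x)
  rw [EuclideanSpace.inner_toLp_toLp] at this
  rw [mul_comm]
  simpa [l2] using this

lemma abs_apply_le_l2 {n : ℕ} (x : Fin n → ℝ) (i : Fin n) : |x i| ≤ l2 x := by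
  simpa [l2] using PiLp.norm_apply_le (WithLp.toLp 2 x) i

lemma l2_single {n : ℕ} (i : Fin n) : l2 (Pi.single i 1) = 1 := by
  have h : l2 (Pi.single i (1 : ℝ)) ^ 2 = 1 := by
    rw [l2_sq_dot]; simp
  nlinarith [l2_nonneg (Pi.single i (1 : ℝ))]

lemma sum_single_one {n : ℕ} (j : Fin n) : ∑ i, (Pi.single j (1 : ℝ) : Fin n → ℝ) i = 1 := by
  simp only [Finset.sum_pi_single', Finset.mem_univ, if_true]

lemma eq_sum_single {n : ℕ} (x : Fin n → ℝ) : x = ∑ i, x i • Pi.single i (1 : ℝ) := by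
  ext j
  simp [Finset.sum_apply, Pi.single_apply]

lemma l2_le_sum_abs {n : ℕ} (x : Fin n → ℝ) : l2 x ≤ ∑ i, |x i| := by
  calc l2 x = l2 (∑ i, x i • Pi.single i (1 : ℝ)) := by rw [← eq_sum_single]
    _ ≤ _ := l2_sum_le _ _
    _ = _ := by simp [l2_smul, l2_single]

lemma l2_mulVec_le {m n : ℕ} (M : Matrix (Fin m) (Fin n) ℝ) (x : Fin n → ℝ) (c : ℝ)
    (hc : ∀ j, l2 (fun i => M i j) ≤ c) : l2 (M *ᵥ x) ≤ c * ∑ j, |x j| := by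
  have h : M *ᵥ x = ∑ j, x j • fun i => M i j := by
    ext i
    simp [mulVec, dotProduct, Finset.sum_apply, mul_comm]
  rw [h, Finset.mul_sum]
  refine (l2_sum_le _ _).trans (Finset.sum_le_sum fun j _ => ?_)
  rw [l2_smul, mul_comm]
  exact mul_le_mul_of_nonneg_right (hc j) (abs_nonneg _)

lemma l2_const_one_le {n : ℕ} (hn : 1 ≤ n) : l2 (fun _ : Fin n => (1 : ℝ)) ≤ n := by
  have h : l2 (fun _ : Fin n => (1 : ℝ)) ^ 2 = n := by simp [l2_sq]
  have hn' : (1 : ℝ) ≤ n := by exact_mod_cast hn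
  nlinarith [l2_nonneg (fun _ : Fin n => (1 : ℝ))]

lemma l2_col_le_normOneTwo {m n : ℕ} (A : Matrix (Fin m) (Fin n) ℝ) (j : Fin n) :
    l2 (fun i => A i j) ≤ normOneTwo A :=
  le_ciSup (f := fun j : Fin n => l2 (fun i => A i j)) (Set.finite_range _).bddAbove j

/-! ### The simplex slice of `C_p` and linear maps bounded on it -/

/-- The unit simplex intersected with the ball of radius `1 / p`. -/
def simplexBall (r : ℕ) (p : ℝ) : Set (Fin r → ℝ) :=
  {y | (∀ i, 0 ≤ y i) ∧ ∑ i, y i = 1 ∧ p * l2 y ≤ 1}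

lemma mul_l2_le_one {n : ℕ} {p : ℝ} (x : Fin n → ℝ) (h : p ^ 2 * ∑ i, x i ^ 2 ≤ 1) :
    p * l2 x ≤ 1 := by
  rw [← l2_sq, ← mul_pow] at h
  exact (abs_le_of_sq_le_sq' (by simpa using h) zero_le_one).2

lemma const_mem_simplexBall {r : ℕ} {p : ℝ} (hr : 2 ≤ r) (hpr : p ^ 2 ≤ r - 1) :
    (fun _ => 1 / (r : ℝ)) ∈ simplexBall r p := by
  have hr' : (2 : ℝ) ≤ r := by exact_mod_cast hr
  refine ⟨fun i => by positivity, ?_, mul_l2_le_one _ ?_⟩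
  · simp; field_simp
  · simp
    field_simp
    linarith

/-- Moving from the barycenter a fraction `1/r` of the way to a vertex stays in the ball: the
squared norm is `(r² + r - 1)/r³`, and `(r - 1)(r² + r - 1) ≤ r³`. -/
lemma mixed_mem_simplexBall {r : ℕ} {p : ℝ} (hr : 2 ≤ r) (hpr : p ^ 2 ≤ r - 1) (j : Fin r) :
    (fun i => (1 - 1 / (r : ℝ)) * (1 / r) + 1 / r * (Pi.single j (1 : ℝ) : Fin r → ℝ) i) ∈
      simplexBall r p := by
  have hr' : (2 : ℝ) ≤ r := by exact_mod_cast hr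
  have h1 : 1 / (r : ℝ) ≤ 1 := by rw [div_le_one (by linarith)]; linarith
  have h2 : 0 ≤ 1 - 1 / (r : ℝ) := by linarith
  refine ⟨fun i => ?_, ?_, mul_l2_le_one _ ?_⟩
  · have : (0 : ℝ) ≤ (Pi.single j (1 : ℝ) : Fin r → ℝ) i := by
      rw [Pi.single_apply]; split_ifs <;> norm_num
    positivity
  · rw [Finset.sum_add_distrib, ← Finset.mul_sum, ← Finset.mul_sum, sum_single_one]
    simp only [Finset.sum_const, Finset.card_univ, Fintype.card_fin, nsmul_eq_mul]
    field_simp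
    ring
  · have h : ∀ i, ((1 - 1 / (r : ℝ)) * (1 / r) + 1 / r * (Pi.single j (1 : ℝ) : Fin r → ℝ) i) ^ 2 =
        ((1 - 1 / (r : ℝ)) * (1 / r)) ^ 2 +
        (2 * ((1 - 1 / (r : ℝ)) * (1 / r)) * (1 / r) + (1 / r) ^ 2) *
          (Pi.single j (1 : ℝ) : Fin r → ℝ) i := by
      intro i
      rw [Pi.single_apply]; split_ifs <;> ring
    simp_rw [h]
    rw [Finset.sum_add_distrib, ← Finset.mul_sum]
    simp only [Finset.sum_const, Finset.card_univ, Fintype.card_fin, nsmul_eq_mul,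
      sum_single_one]
    have h3 : (r : ℝ) * ((1 - 1 / (r : ℝ)) * (1 / r)) ^ 2 +
        (2 * ((1 - 1 / (r : ℝ)) * (1 / r)) * (1 / r) + (1 / r) ^ 2) * 1 =
        (r ^ 2 + r - 1) / r ^ 3 := by
      field_simp
      ring
    rw [h3, mul_div_assoc', div_le_one (by positivity)]
    nlinarith [mul_le_mul_of_nonneg_right hpr (show (0 : ℝ) ≤ r ^ 2 + r - 1 by nlinarith)]

/-- The vertex `e_j` need not lie in the slice, but it is the combination `r y₁ - (r - 1) y₀` of two
points that do, so passing to vertices costs a factor `2r - 1`. -/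
lemma norm_apply_single_le {r : ℕ} {p : ℝ} (hr : 2 ≤ r) (hpr : p ^ 2 ≤ r - 1)
    {E : Type*} [NormedAddCommGroup E] [NormedSpace ℝ E] (L : (Fin r → ℝ) →ₗ[ℝ] E) {c : ℝ}
    (hL : ∀ y ∈ simplexBall r p, ‖L y‖ ≤ c) (j : Fin r) :
    ‖L (Pi.single j 1)‖ ≤ 2 * r * c := by
  have hr' : (2 : ℝ) ≤ r := by exact_mod_cast hr
  set y0 : Fin r → ℝ := fun _ => 1 / (r : ℝ) with hy0
  set y1 : Fin r → ℝ :=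
    fun i => (1 - 1 / (r : ℝ)) * (1 / r) + 1 / r * (Pi.single j (1 : ℝ) : Fin r → ℝ) i with hy1
  have h0 := hL y0 (const_mem_simplexBall hr hpr)
  have h1 := hL y1 (mixed_mem_simplexBall hr hpr j)
  have h : (Pi.single j 1 : Fin r → ℝ) = (r : ℝ) • y1 - ((r : ℝ) - 1) • y0 := by
    ext i
    simp only [hy0, hy1, Pi.sub_apply, Pi.smul_apply, smul_eq_mul]
    field_simp
    ring
  rw [h, map_sub, map_smul, map_smul]
  refine (norm_sub_le _ _).trans ?_
  rw [norm_smul, norm_smul, Real.norm_of_nonneg (by linarith), Real.norm_of_nonneg (by linarith)]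
  have := norm_nonneg (L y0)
  nlinarith

lemma abs_apply_le_of_simplexBall {r : ℕ} {p : ℝ} (hr : 2 ≤ r) (hpr : p ^ 2 ≤ r - 1)
    (w : Fin r → ℝ) {c : ℝ} (hw : ∀ y ∈ simplexBall r p, |w ⬝ᵥ y| ≤ c) (j : Fin r) :
    |w j| ≤ 2 * r * c := by
  have := norm_apply_single_le hr hpr (dotProductBilin ℝ ℝ w) (c := c)
    (fun y hy => by simpa using hw y hy) j
  simpa using this

lemma l2_col_le_of_simplexBall {m r : ℕ} {p : ℝ} (hr : 2 ≤ r) (hpr : p ^ 2 ≤ r - 1)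
    (M : Matrix (Fin m) (Fin r) ℝ) {c : ℝ} (hM : ∀ y ∈ simplexBall r p, l2 (M *ᵥ y) ≤ c)
    (j : Fin r) : l2 (fun i => M i j) ≤ 2 * r * c := by
  have := norm_apply_single_le hr hpr
    ((WithLp.linearEquiv 2 ℝ (Fin m → ℝ)).symm.toLinearMap ∘ₗ M.mulVecLin) (c := c)
    (fun y hy => by simpa [l2] using hM y hy) j
  simp only [LinearMap.coe_comp, Function.comp_apply, mulVecLin_apply, mulVec_single_one] at this
  exact this

/-! ### The dual of `C_p` and concentration on a coordinate -/

lemma l2_le_of_abs_le {n : ℕ} {x y : Fin n → ℝ} (h : ∀ i, |x i| ≤ |y i|) : l2 x ≤ l2 y := by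
  refine abs_le_of_sq_le_sq' ?_ (l2_nonneg y) |>.2
  rw [l2_sq, l2_sq]
  exact Finset.sum_le_sum fun i _ => sq_le_sq.2 (h i)

lemma continuous_l2 {n : ℕ} : Continuous (l2 : (Fin n → ℝ) → ℝ) :=
  continuous_norm.comp (PiLp.continuous_toLp 2 _)

/-- A vector in the dual of `C_p` is the sum of a nonnegative vector and a vector of the dual of
the circular cone, obtained by truncating the entries from above. -/
lemma exists_add_of_dual_coneC {r : ℕ} {p q : ℝ} (hq : 0 < q) (hpq : q ^ 2 = r - p ^ 2)
    (a : Fin r → ℝ) (ha : ∀ y ∈ coneC r p, 0 ≤ a ⬝ᵥ y) :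
    ∃ u v : Fin r → ℝ, a = u + v ∧ (∀ i, 0 ≤ u i) ∧ q * l2 v ≤ ∑ i, v i := by
  by_cases hpos : ∀ i, 0 ≤ a i
  · exact ⟨a, 0, by simp, hpos, by simp [l2_zero]⟩
  push Not at hpos
  obtain ⟨i₀, hi₀⟩ := hpos
  -- A zero of `f` is a truncation level `t` with `‖min(a, t)‖ = q t`; the negative entry of `a`
  -- makes `f 0` positive.
  set f : ℝ → ℝ := fun t => l2 (fun i => min (a i) t) - q * t with hf
  have hfc : Continuous f := by
    refine (continuous_l2.comp ?_).sub (by fun_prop)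
    exact continuous_pi fun i => by fun_prop
  have hT : 0 ≤ l2 a / q := div_nonneg (l2_nonneg a) hq.le
  have hf0 : 0 < f 0 := by
    have := abs_apply_le_l2 (fun i => min (a i) 0) i₀
    simp only [min_eq_left hi₀.le] at this
    have h2 : 0 < |a i₀| := abs_pos.2 hi₀.ne
    simp only [hf]
    linarith
  have hfT : f (l2 a / q) ≤ 0 := by
    have : l2 (fun i => min (a i) (l2 a / q)) ≤ l2 a := by
      refine l2_le_of_abs_le fun i => ?_
      rcases le_total (a i) (l2 a / q) with h | h
      · simp [h]
      · simp only [min_eq_right h]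
        exact abs_le_abs_of_nonneg hT h
    simp only [hf]
    rw [mul_div_cancel₀ _ hq.ne']
    linarith
  obtain ⟨t, ht, hft⟩ := intermediate_value_Icc' hT hfc.continuousOn ⟨hfT, hf0.le⟩
  have ht0 : 0 < t := by
    refine lt_of_le_of_ne ht.1 fun h => ?_
    rw [← h] at hft
    exact hf0.ne' hft
  set v : Fin r → ℝ := fun i => min (a i) t with hv
  have hvt : l2 v = q * t := by simp only [hf] at hft; linarith
  refine ⟨a - v, v, by simp, fun i => by simp [hv], ?_⟩
  have hvsq : ∑ i, v i * v i = (q * t) ^ 2 := by rw [← hvt, l2_sq_dot]; rfl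
  have hvle : ∀ i, v i ≤ t := fun i => min_le_right _ _
  have hsle : ∑ i, v i ≤ r * t := by
    simpa using Finset.sum_le_sum (s := Finset.univ) fun i _ => hvle i
  set S := ∑ i, v i with hS
  -- The choice of `t` makes `(∑ y)² - p² ‖y‖²` equal to the perfect square `(S - q² t)²`.
  have hy : (fun i => t - v i) ∈ coneC r p := by
    refine ⟨fun i => sub_nonneg.2 (hvle i), ?_⟩
    change p * l2 (fun i => t - v i) ≤ _
    have hsum : ∑ i, (t - v i) = r * t - S := by simp [hS]
    rw [hsum]
    refine (abs_le_of_sq_le_sq' ?_ (by linarith)).2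
    have h1 : ∑ i, (t - v i) ^ 2 = r * t ^ 2 - 2 * t * S + (q * t) ^ 2 := by
      rw [← hvsq, hS, Finset.mul_sum]
      simp only [sub_sq, Finset.sum_add_distrib, Finset.sum_sub_distrib]
      simp [sq]
    rw [mul_pow, l2_sq, h1]
    have hp2 : p ^ 2 = r - q ^ 2 := by linarith
    rw [hp2]
    nlinarith [sq_nonneg (S - q ^ 2 * t)]
  have hay := ha _ hy
  -- Where truncation changed `a`, the factor `t - v i` vanishes, so `a` may be replaced by `v`.
  -- Nonnegativity then reads `t S ≥ (q t)²`, that is, `S ≥ q ‖v‖`.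
  have h2 : a ⬝ᵥ (fun i => t - v i) = ∑ i, (t * v i - v i * v i) := by
    refine Finset.sum_congr rfl fun i _ => ?_
    rcases le_total (a i) t with h | h
    · simp only [hv, min_eq_left h]; ring
    · simp only [hv, min_eq_right h]; ring
  rw [h2, Finset.sum_sub_distrib, ← Finset.mul_sum, hvsq] at hay
  rw [hvt]
  refine le_of_mul_le_mul_left ?_ ht0
  nlinarith

/-- A nonnegative vector whose `ℓ¹` and `ℓ²` norms are close is close to a coordinate axis. -/
lemma exists_sum_sub_apply_le {r : ℕ} (hr : 0 < r) (u : Fin r → ℝ) (hu : ∀ i, 0 ≤ u i) :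
    ∃ k, ∑ i, u i - u k ≤ 2 * (∑ i, u i - l2 u) := by
  have : Nonempty (Fin r) := ⟨⟨0, hr⟩⟩
  obtain ⟨k, hk⟩ := Finite.exists_max u
  refine ⟨k, ?_⟩
  have h1 : l2 u ^ 2 ≤ u k * ∑ i, u i := by
    rw [l2_sq, Finset.mul_sum]
    exact Finset.sum_le_sum fun i _ => by nlinarith [hu i, hk i]
  have h2 : 0 ≤ ∑ i, u i := Finset.sum_nonneg fun i _ => hu i
  have h3 := hu k
  have h4 : l2 u ≤ (u k + ∑ i, u i) / 2 := by
    refine (abs_le_of_sq_le_sq' ?_ (by linarith)).2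
    nlinarith [sq_nonneg (u k - ∑ i, u i)]
  linarith

lemma l2_le_sum_of_nonneg {n : ℕ} {u : Fin n → ℝ} (hu : ∀ i, 0 ≤ u i) : l2 u ≤ ∑ i, u i :=
  (l2_le_sum_abs u).trans_eq (Finset.sum_congr rfl fun i _ => abs_of_nonneg (hu i))

/-- From `simplexBall` to the cone it spans. -/
lemma dot_nonneg_of_simplexBall {r : ℕ} {p : ℝ} {a : Fin r → ℝ}
    (ha : ∀ y ∈ simplexBall r p, 0 ≤ a ⬝ᵥ y) (y : Fin r → ℝ) (hy : y ∈ coneC r p) :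
    0 ≤ a ⬝ᵥ y := by
  obtain ⟨hy0, hy1⟩ := hy
  have hs : 0 ≤ ∑ i, y i := Finset.sum_nonneg fun i _ => hy0 i
  rcases hs.eq_or_lt with h | h
  · have : y = 0 := by
      ext i
      exact (Finset.sum_eq_zero_iff_of_nonneg fun i _ => hy0 i).1 h.symm i (Finset.mem_univ i)
    simp [this]
  · have hmem : (∑ i, y i)⁻¹ • y ∈ simplexBall r p := by
      refine ⟨fun i => ?_, ?_, ?_⟩
      · have := hy0 i
        simp only [Pi.smul_apply, smul_eq_mul]; positivity
      · simp only [Pi.smul_apply, smul_eq_mul, ← Finset.mul_sum]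
        exact inv_mul_cancel₀ h.ne'
      · rw [l2_smul, abs_of_pos (by positivity)]
        change p * l2 y ≤ _ at hy1
        have : p * ((∑ i, y i)⁻¹ * l2 y) = (p * l2 y) / ∑ i, y i := by ring
        rw [this]
        exact div_le_one_of_le₀ hy1 h.le
    have := ha _ hmem
    rw [dotProduct_smul, smul_eq_mul] at this
    exact nonneg_of_mul_nonneg_right this (by positivity)

/-- A vector that is nearly nonnegative on `simplexBall r p` is, up to its defect
`∑ a - ‖a‖`, concentrated on one coordinate. -/
lemma exists_peak {r : ℕ} {p q κ δ : ℝ} (hr : 2 ≤ r) (hκ0 : 0 < κ) (hκ : κ ≤ 1 / 2)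
    (hκq : κ ≤ q - 1) (hpq : q ^ 2 = r - p ^ 2) (hδ : 0 ≤ δ) (a : Fin r → ℝ)
    (ha : ∀ y ∈ simplexBall r p, -(δ * l2 a) ≤ a ⬝ᵥ y) :
    ∃ (k : Fin r) (d : ℝ), 0 ≤ d ∧ (1 - 2 * r * δ) * l2 a ≤ ∑ i, a i - d ∧
      ∀ i ≠ k, |a i| ≤ 2 * d / κ + δ * l2 a := by
  have hr' : (2 : ℝ) ≤ r := by exact_mod_cast hr
  set c := δ * l2 a with hc
  have hc0 : 0 ≤ c := mul_nonneg hδ (l2_nonneg a)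
  -- Points of the slice have entry sum one, so adding `c` to every entry cancels the allowed
  -- negativity exactly.
  set a' : Fin r → ℝ := a + c • fun _ => 1 with ha'
  have h1 : ∀ y ∈ simplexBall r p, 0 ≤ a' ⬝ᵥ y := by
    intro y hy
    have h := ha y hy
    have h2 : (fun _ : Fin r => (1 : ℝ)) ⬝ᵥ y = 1 := by simpa [dotProduct] using hy.2.1
    rw [ha', add_dotProduct, smul_dotProduct, h2]
    simp only [smul_eq_mul]
    linarith
  obtain ⟨u, v, huv, hu, hv⟩ := exists_add_of_dual_coneC (by linarith : 0 < q) hpq a'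
    (dot_nonneg_of_simplexBall h1)
  obtain ⟨k, hk⟩ := exists_sum_sub_apply_le (by omega : 0 < r) u hu
  have hul := l2_le_sum_of_nonneg hu
  have hv0 := l2_nonneg v
  have hvs : 0 ≤ ∑ i, v i - l2 v := by nlinarith
  have hsum : ∑ i, a i + r * c = ∑ i, u i + ∑ i, v i := by
    rw [← Finset.sum_add_distrib]
    have : ∀ i, u i + v i = a i + c := fun i => by
      have := congrFun huv i
      simp [ha'] at this
      exact this.symm
    simp [this, Finset.sum_add_distrib]
  refine ⟨k, (∑ i, u i - l2 u) + (∑ i, v i - l2 v), by linarith, ?_, fun i hi => ?_⟩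
  · have h2 : l2 a ≤ l2 u + l2 v + c * r := by
      have h3 : a = (u + v) - c • fun _ => 1 := by rw [← huv, ha']; simp
      calc l2 a = l2 ((u + v) - c • fun _ => 1) := by rw [← h3]
        _ ≤ l2 (u + v) + l2 (c • fun _ => 1) := l2_sub_le _ _
        _ ≤ _ := by
          rw [l2_smul, abs_of_nonneg hc0]
          exact add_le_add (l2_add_le _ _)
            (mul_le_mul_of_nonneg_left (l2_const_one_le (by omega)) hc0)
    have h4 : (1 - 2 * r * δ) * l2 a = l2 a - 2 * r * c := by rw [hc]; ring
    rw [h4]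
    linarith
  · have hai : a i = u i + v i - c := by
      have := congrFun huv i
      simp [ha'] at this
      linarith
    have hui : u i ≤ ∑ i, u i - u k := by
      rw [← Finset.sum_erase_add _ _ (Finset.mem_univ k)]
      simp only [add_sub_cancel_right]
      exact Finset.single_le_sum (f := u) (fun j _ => hu j) (by simp [hi])
    have h5 : |a i| ≤ u i + l2 v + c := by
      have := abs_le.1 (abs_apply_le_l2 v i)
      rw [hai, abs_le]
      constructor <;> linarith [hu i]
    have h6 : 2 * (∑ i, u i - l2 u) ≤ 2 * (∑ i, u i - l2 u) / κ := by
      rw [le_div_iff₀ hκ0]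
      nlinarith
    -- The gap `q - 1 ≥ κ` enters here: the defect of `v` is at least `(q - 1)‖v‖`.
    have h7 : l2 v ≤ 2 * (∑ i, v i - l2 v) / κ := by
      rw [le_div_iff₀ hκ0]
      nlinarith
    have h8 : 2 * ((∑ i, u i - l2 u) + (∑ i, v i - l2 v)) / κ =
      2 * (∑ i, u i - l2 u) / κ + 2 * (∑ i, v i - l2 v) / κ := by ring
    rw [h8]
    linarith

/-! ### Matrices close to a permutation -/

/-- Hadamard's inequality. -/
lemma abs_det_le_prod_l2 {n : ℕ} (A : Matrix (Fin n) (Fin n) ℝ) :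
    |A.det| ≤ ∏ i, l2 (A i) := by
  have : Fact (Module.finrank ℝ (EuclideanSpace ℝ (Fin n)) = n) := ⟨by simp⟩
  let b := EuclideanSpace.basisFun (Fin n) ℝ
  have h := b.toBasis.orientation.abs_volumeForm_apply_le (fun i => WithLp.toLp 2 (A i))
  rw [Orientation.volumeForm_robust' _ b, Module.Basis.det_apply] at h
  have h2 : b.toBasis.toMatrix (fun i => WithLp.toLp 2 (A i)) = Aᵀ := by
    ext i j
    simp [b, Module.Basis.toMatrix_apply]
  rw [h2, det_transpose] at h
  exact h

/-- AM-GM, from `x ≤ exp (x - 1)` applied to each `x i / θ`. -/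
lemma card_mul_le_sum_of_pow_le_prod {n : ℕ} {θ : ℝ} (hθ : 0 < θ) (x : Fin n → ℝ)
    (hx : ∀ i, 0 ≤ x i) (h : θ ^ n ≤ ∏ i, x i) : n * θ ≤ ∑ i, x i := by
  have h1 : ∏ i, x i / θ ≤ Real.exp (∑ i, (x i / θ - 1)) := by
    rw [Real.exp_sum]
    refine Finset.prod_le_prod (fun i _ => div_nonneg (hx i) hθ.le) fun i _ => ?_
    have := Real.add_one_le_exp (x i / θ - 1)
    linarith
  have h2 : 1 ≤ ∏ i, x i / θ := by
    rw [Finset.prod_div_distrib]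
    simp only [Finset.prod_const, Finset.card_univ, Fintype.card_fin]
    rwa [one_le_div (by positivity)]
  have h3 : 0 ≤ ∑ i, (x i / θ - 1) := Real.one_le_exp_iff.1 (h2.trans h1)
  rw [Finset.sum_sub_distrib, ← Finset.sum_div] at h3
  simp only [Finset.sum_const, Finset.card_univ, Fintype.card_fin, nsmul_eq_mul, mul_one] at h3
  rw [sub_nonneg, le_div_iff₀ hθ] at h3
  exact h3

/-- A square matrix of determinant at least one that is nearly nonnegative and nearly
sum-preserving on `simplexBall r p` is close to a permutation matrix. -/
lemma exists_perm_close {r : ℕ} {p q κ δ : ℝ} (hr : 2 ≤ r) (hpr : p ^ 2 ≤ r - 1)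
    (hκ0 : 0 < κ) (hκ : κ ≤ 1 / 2) (hκq : κ ≤ q - 1) (hpq : q ^ 2 = r - p ^ 2) (hδ : 0 ≤ δ)
    (hδs : 11 * (r ^ 2 * δ / κ) < 1)
    (A : Matrix (Fin r) (Fin r) ℝ) (hdet : 1 ≤ |A.det|)
    (hrow : ∀ y ∈ simplexBall r p, ∀ i, -(δ * l2 (A i)) ≤ A i ⬝ᵥ y)
    (hcol : ∀ y ∈ simplexBall r p, |(fun j => ∑ i, A i j) ⬝ᵥ y - 1| ≤
      δ * l2 (fun j => ∑ i, A i j)) :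
    ∃ π : Equiv.Perm (Fin r), ∀ j, ∑ i, |A i j - π.permMatrix ℝ i j| ≤ 20 * (r ^ 2 * δ / κ) := by
  have hr' : (2 : ℝ) ≤ r := by exact_mod_cast hr
  set w : Fin r → ℝ := fun j => ∑ i, A i j with hw
  set ψ := r ^ 2 * δ / κ with hψ
  have hψ0 : 0 ≤ ψ := by positivity
  have hψδ : 2 * (r ^ 2 * δ) ≤ ψ := by
    rw [hψ, le_div_iff₀ hκ0]
    have : 0 ≤ r ^ 2 * δ := by positivity
    nlinarith
  have hrδ : 2 * (r * δ) ≤ r ^ 2 * δ := by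
    have : 0 ≤ r * δ := by positivity
    nlinarith
  have hrδ0 : 0 ≤ r * δ := by positivity
  have hw1 : ∀ j, |w j - 1| ≤ 2 * r * (δ * l2 w) := by
    intro j
    have := abs_apply_le_of_simplexBall hr hpr (w - fun _ => 1) (c := δ * l2 w) (fun y hy => by
      have h2 : (fun _ : Fin r => (1 : ℝ)) ⬝ᵥ y = 1 := by simpa [dotProduct] using hy.2.1
      rw [sub_dotProduct, h2]
      exact hcol y hy) j
    simpa using this
  have hwl : l2 w ≤ 2 * r := by
    -- The bound involves `‖w‖` itself; it closes because `2r²δ` is well below `1/2`.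
    have h1 : l2 w ≤ r * (1 + 2 * r * (δ * l2 w)) := by
      refine (l2_le_sum_abs w).trans ?_
      have : ∀ j ∈ (Finset.univ : Finset (Fin r)), |w j| ≤ 1 + 2 * r * (δ * l2 w) := fun j _ => by
        have := hw1 j
        have h3 : |w j| ≤ |w j - 1| + |(1 : ℝ)| := by
          simpa using abs_add_le (w j - 1) 1
        rw [abs_one] at h3
        linarith
      refine (Finset.sum_le_sum this).trans_eq ?_
      simp only [Finset.sum_const, Finset.card_univ, Fintype.card_fin, nsmul_eq_mul]
    nlinarith [l2_nonneg w]
  have hw2 : ∀ j, |w j - 1| ≤ 2 * ψ := by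
    intro j
    refine (hw1 j).trans ?_
    have : 2 * r * (δ * l2 w) ≤ 4 * (r ^ 2 * δ) := by nlinarith
    linarith
  have hpeak := fun i => exists_peak hr hκ0 hκ hκq hpq hδ (A i) (fun y hy => hrow y hy i)
  choose k d hd0 hdA hoff using hpeak
  set θ := 1 - 2 * r * δ with hθ
  have hθ0 : 1 / 2 ≤ θ := by rw [hθ]; linarith
  have hs : ∑ i, ∑ j, A i j ≤ r * (1 + 2 * r * δ) := by
    have h0 := hcol _ (const_mem_simplexBall (p := p) hr hpr)
    have h1 : w ⬝ᵥ (fun _ => 1 / (r : ℝ)) = (∑ i, ∑ j, A i j) / r := by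
      have h2 : ∑ i, ∑ j, A i j = ∑ j, w j := Finset.sum_comm
      rw [h2, Finset.sum_div]
      simp [dotProduct, div_eq_mul_inv]
    rw [h1] at h0
    have h2 : (∑ i, ∑ j, A i j) / r ≤ 1 + 2 * r * δ := by
      have := (abs_le.1 h0).2
      nlinarith
    rw [div_le_iff₀ (by linarith)] at h2
    linarith
  -- Hadamard and AM-GM bound the total of sums minus defects below by `rθ = r - 2r²δ`; the total of
  -- sums is at most `r + 2r²δ`.
  have hds : ∑ i, d i ≤ 4 * (r ^ 2 * δ) := by
    have h1 : r * θ ≤ ∑ i, (∑ j, A i j - d i) := by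
      refine card_mul_le_sum_of_pow_le_prod (by linarith) _ (fun i => ?_) ?_
      · exact (mul_nonneg (by linarith) (l2_nonneg _)).trans (hdA i)
      · calc θ ^ r ≤ θ ^ r * ∏ i, l2 (A i) :=
            le_mul_of_one_le_right (by positivity) (hdet.trans (abs_det_le_prod_l2 A))
          _ = ∏ i, θ * l2 (A i) := by
            rw [Finset.prod_mul_distrib]; simp
          _ ≤ _ := Finset.prod_le_prod
            (fun i _ => mul_nonneg (by linarith) (l2_nonneg _)) fun i _ => hdA i
    rw [Finset.sum_sub_distrib] at h1
    have h2 : r * θ = r - 2 * (r ^ 2 * δ) := by rw [hθ]; ring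
    linarith [h2]
  have hAs : ∑ i, l2 (A i) ≤ 4 * r := by
    have h1 : θ * ∑ i, l2 (A i) ≤ ∑ i, ∑ j, A i j := by
      rw [Finset.mul_sum]
      exact Finset.sum_le_sum fun i _ => (hdA i).trans (by linarith [hd0 i])
    have h2 : 0 ≤ ∑ i, l2 (A i) := Finset.sum_nonneg fun i _ => l2_nonneg _
    nlinarith
  have hF : ∀ j, ∑ i, (if k i = j then 0 else |A i j|) ≤ 9 * ψ := by
    intro j
    calc ∑ i, (if k i = j then 0 else |A i j|) ≤ ∑ i, (2 * d i / κ + δ * l2 (A i)) := by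
          refine Finset.sum_le_sum fun i _ => ?_
          split_ifs with h
          · have := hd0 i
            have := l2_nonneg (A i)
            positivity
          · exact hoff i j (Ne.symm h)
      _ = 2 * (∑ i, d i) / κ + δ * ∑ i, l2 (A i) := by
          rw [Finset.sum_add_distrib, Finset.mul_sum, Finset.mul_sum, Finset.sum_div]
      _ ≤ 8 * ψ + ψ := by
          refine add_le_add ?_ ?_
          · rw [hψ, mul_div_assoc', div_le_div_iff_of_pos_right hκ0]
            linarith
          · nlinarith
      _ = 9 * ψ := by ring
  -- A column holding no peak would have sum at most `9ψ`, against at least `1 - 2ψ`; hence the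
  -- requirement `11ψ < 1`.
  have hsurj : Function.Surjective k := by
    intro j
    by_contra! hne
    have h1 : w j ≤ 9 * ψ := by
      refine le_trans (Finset.sum_le_sum fun i _ => ?_) (hF j)
      rw [if_neg (hne i)]
      exact le_abs_self _
    have := (abs_le.1 (hw2 j)).1
    linarith
  have hbij : Function.Bijective k := Finite.surjective_iff_bijective.1 hsurj
  let π : Equiv.Perm (Fin r) := Equiv.ofBijective k hbij
  refine ⟨π, fun j => ?_⟩
  obtain ⟨i₀, rfl⟩ := hsurj j
  have hP : ∀ i, π.permMatrix ℝ i (k i₀) = if i = i₀ then 1 else 0 := by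
    intro i
    have : π.permMatrix ℝ i (k i₀) = if k i₀ = k i then 1 else 0 := by
      simp [Equiv.Perm.permMatrix, PEquiv.toMatrix_apply, π, eq_comm]
    simp only [this, hbij.1.eq_iff, eq_comm]
  simp_rw [hP]
  have hF' := hF (k i₀)
  simp_rw [hbij.1.eq_iff] at hF'
  rw [← Finset.add_sum_erase _ _ (Finset.mem_univ i₀)] at hF' ⊢
  rw [if_pos rfl] at hF' ⊢
  have e1 : ∑ i ∈ Finset.univ.erase i₀, |A i (k i₀) - if i = i₀ then 1 else 0| =
      ∑ i ∈ Finset.univ.erase i₀, |A i (k i₀)| :=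
    Finset.sum_congr rfl fun i hi => by simp [Finset.ne_of_mem_erase hi]
  have e2 : ∑ i ∈ Finset.univ.erase i₀, (if i = i₀ then 0 else |A i (k i₀)|) =
      ∑ i ∈ Finset.univ.erase i₀, |A i (k i₀)| :=
    Finset.sum_congr rfl fun i hi => by simp [Finset.ne_of_mem_erase hi]
  rw [e2, zero_add] at hF'
  rw [e1]
  have e3 : A i₀ (k i₀) - 1 = (w (k i₀) - 1) - ∑ i ∈ Finset.univ.erase i₀, A i (k i₀) := by
    simp only [hw]
    rw [← Finset.add_sum_erase _ _ (Finset.mem_univ i₀)]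
    ring
  have e4 : |A i₀ (k i₀) - 1| ≤ 2 * ψ + 9 * ψ := by
    rw [e3]
    refine (abs_sub _ _).trans (add_le_add (hw2 _) ?_)
    exact (Finset.abs_sum_le_sum_abs _ _).trans hF'
  linarith

/-! ### Gram determinants, singular values and projection -/

/-- At a unit eigenvector `v` the eigenvalue is `1 + ‖S v‖²`. -/
lemma one_le_det_one_add_transpose_mul_self {m n : ℕ} (S : Matrix (Fin m) (Fin n) ℝ) :
    1 ≤ (1 + Sᵀ * S).det := by
  have hA : (1 + Sᵀ * S).IsHermitian := by
    simp [IsHermitian, conjTranspose_eq_transpose_of_trivial]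
  rw [hA.det_eq_prod_eigenvalues]
  have h1 : ∀ i, 1 ≤ hA.eigenvalues i := by
    intro i
    set v : Fin n → ℝ := ⇑(hA.eigenvectorBasis i) with hv
    have hv1 : v ⬝ᵥ v = 1 := by
      rw [← l2_sq_dot]
      have : l2 v = 1 := hA.eigenvectorBasis.orthonormal.1 i
      rw [this, one_pow]
    have h := hA.eigenvalues_eq i
    rw [← hv, star_trivial, add_mulVec, one_mulVec, dotProduct_add, hv1, ← mulVec_mulVec,
      dotProduct_mulVec, vecMul_transpose, ← l2_sq_dot] at h
    rw [h]
    simpa using sq_nonneg (l2 (S *ᵥ v))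
  simpa using Finset.prod_le_prod (s := Finset.univ) (f := fun _ : Fin n => (1 : ℝ))
    (fun _ _ => zero_le_one) fun i _ => h1 i

open scoped MatrixOrder ComplexOrder Matrix.Norms.L2Operator in
lemma exists_eq_transpose_mul_self {n : ℕ} {G : Matrix (Fin n) (Fin n) ℝ} (hG : G.PosSemidef) :
    ∃ C, G = Cᵀ * C := by
  obtain ⟨C, hC⟩ := CStarAlgebra.nonneg_iff_eq_star_mul_self.mp hG.nonneg
  exact ⟨C, by rw [hC, star_eq_conjTranspose, conjTranspose_eq_transpose_of_trivial]⟩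

lemma det_le_det_add_transpose_mul_self {m n : ℕ} {G : Matrix (Fin n) (Fin n) ℝ} (hG : G.PosDef)
    (T : Matrix (Fin m) (Fin n) ℝ) : G.det ≤ (G + Tᵀ * T).det := by
  obtain ⟨C, rfl⟩ := exists_eq_transpose_mul_self hG.posSemidef
  have hd := hG.det_pos
  rw [det_mul, det_transpose] at hd
  have hu : IsUnit C.det := isUnit_iff_ne_zero.2 fun h => by simp [h] at hd
  have h : Cᵀ * C + Tᵀ * T = Cᵀ * (1 + (T * C⁻¹)ᵀ * (T * C⁻¹)) * C := by
    have e1 : T = T * C⁻¹ * C := by rw [Matrix.mul_assoc, nonsing_inv_mul _ hu, Matrix.mul_one]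
    conv_lhs => rw [e1]
    simp only [transpose_mul, Matrix.mul_add, Matrix.add_mul, Matrix.mul_assoc, Matrix.mul_one]
  rw [h, det_mul, det_mul, det_mul, det_transpose]
  nlinarith [one_le_det_one_add_transpose_mul_self (T * C⁻¹)]

/-- In an eigenbasis of the adjoint of `W` composed with `W`, `σ_r²` is the least of the `r`
eigenvalues, the one with zero-based index `r - 1`. -/
lemma singularValue_mul_l2_le {m r : ℕ} (hr : 1 ≤ r) (W : Matrix (Fin m) (Fin r) ℝ)
    (x : Fin r → ℝ) : singularValue W r * l2 x ≤ l2 (W *ᵥ x) := by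
  set T := Matrix.toEuclideanLin W with hT
  have hn : Module.finrank ℝ (EuclideanSpace ℝ (Fin r)) = r := by simp
  have hs := T.isSymmetric_adjoint_comp_self
  set b := hs.eigenvectorBasis hn
  set X : EuclideanSpace ℝ (Fin r) := WithLp.toLp 2 x with hX
  have h1 : ‖T X‖ ^ 2 = ∑ i, hs.eigenvalues hn i * (b.repr X i) ^ 2 := by
    have : ‖T X‖ ^ 2 = inner ℝ ((LinearMap.adjoint T ∘ₗ T) X) X := by
      rw [LinearMap.comp_apply, LinearMap.adjoint_inner_left, real_inner_self_eq_norm_sq]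
    rw [this, ← b.repr.inner_map_map, PiLp.inner_apply]
    refine Finset.sum_congr rfl fun i _ => ?_
    rw [hs.eigenvectorBasis_apply_self_apply hn]
    simp
    ring
  have h2 : ‖X‖ ^ 2 = ∑ i, (b.repr X i) ^ 2 := by
    rw [← b.repr.norm_map, EuclideanSpace.real_norm_sq_eq]
  have h3 : (singularValue W r * ‖X‖) ^ 2 ≤ ‖T X‖ ^ 2 := by
    rw [mul_pow, h1, h2, Finset.mul_sum]
    refine Finset.sum_le_sum fun i _ => ?_
    refine mul_le_mul_of_nonneg_right ?_ (sq_nonneg _)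
    rw [singularValue, T.sq_singularValues_of_lt hn (by omega : r - 1 < r)]
    refine hs.eigenvalues_antitone hn ?_
    rw [Fin.le_def]
    have := i.2
    simp only
    omega
  have h4 := (abs_le_of_sq_le_sq' h3 (norm_nonneg _)).2
  simpa [hX, hT, l2, Matrix.toLpLin_apply] using h4

lemma singularValue_pos {m r : ℕ} (hr : 1 ≤ r) {W : Matrix (Fin m) (Fin r) ℝ} (hW : W.rank = r) :
    0 < singularValue W r := by
  rw [singularValue, LinearMap.singularValues_pos_iff_lt_finrank_range]
  have := Matrix.rank_eq_finrank_range_toLin W (EuclideanSpace.basisFun (Fin m) ℝ).toBasis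
    (EuclideanSpace.basisFun (Fin r) ℝ).toBasis
  rw [← Matrix.toEuclideanLin_eq_toLin_orthonormal] at this
  change r - 1 < Module.finrank ℝ (Matrix.toEuclideanLin W).range
  rw [← this, hW]
  omega

lemma l2_mulVec_le_spectralNorm {m n : ℕ} (W : Matrix (Fin m) (Fin n) ℝ) (x : Fin n → ℝ) :
    l2 (W *ᵥ x) ≤ spectralNorm W * l2 x := by
  have := (LinearMap.toContinuousLinearMap (Matrix.toEuclideanLin W)).le_opNorm (WithLp.toLp 2 x)
  simpa [l2, spectralNorm, Matrix.toLpLin_apply] using this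

lemma l2_col_le_spectralNorm {m n : ℕ} (W : Matrix (Fin m) (Fin n) ℝ) (j : Fin n) :
    l2 (fun i => W i j) ≤ spectralNorm W := by
  have := l2_mulVec_le_spectralNorm W (Pi.single j 1)
  rw [l2_single, mul_one, mulVec_single_one] at this
  exact this

lemma posDef_transpose_mul_self {m r : ℕ} (hr : 1 ≤ r) {W : Matrix (Fin m) (Fin r) ℝ}
    (hW : W.rank = r) : (Wᵀ * W).PosDef := by
  rw [← conjTranspose_eq_transpose_of_trivial]
  refine PosDef.conjTranspose_mul_self W ?_
  change Function.Injective W.mulVecLin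
  rw [injective_iff_map_eq_zero]
  intro x hx
  have h := singularValue_mul_l2_le hr W x
  rw [← mulVecLin_apply, hx, l2_zero] at h
  exact eq_zero_of_l2_eq_zero (le_antisymm
    (nonpos_of_mul_nonpos_right h (singularValue_pos hr hW)) (l2_nonneg x))

/-- The left inverse of `W` followed by `W` is an orthogonal projection. -/
lemma l2_projection_le {m r : ℕ} {W : Matrix (Fin m) (Fin r) ℝ} (hW : IsUnit (Wᵀ * W).det)
    (x : Fin m → ℝ) : l2 (W *ᵥ ((Wᵀ * W)⁻¹ *ᵥ (Wᵀ *ᵥ x))) ≤ l2 x := by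
  set t := (Wᵀ * W)⁻¹ *ᵥ (Wᵀ *ᵥ x) with ht
  have h1 : Wᵀ *ᵥ (W *ᵥ t) = Wᵀ *ᵥ x := by
    rw [ht, mulVec_mulVec, mulVec_mulVec _ (Wᵀ * W), mul_nonsing_inv _ hW, one_mulVec]
  have h2 : l2 (W *ᵥ t) ^ 2 = (W *ᵥ t) ⬝ᵥ x := by
    rw [l2_sq_dot, ← vecMul_transpose, ← dotProduct_mulVec, ← dotProduct_mulVec,
      vecMul_transpose, h1]
  have h3 := (le_abs_self _).trans (abs_dot_le (W *ᵥ t) x)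
  rw [← h2] at h3
  rcases (l2_nonneg (W *ᵥ t)).eq_or_lt with h | h
  · rw [← h]; exact l2_nonneg x
  · exact le_of_mul_le_mul_left (by linarith) h

/-! ### From feasibility to the linear robustness estimate -/

lemma coneC_of_simplexBall {r : ℕ} {p : ℝ} {y : Fin r → ℝ} (hy : y ∈ simplexBall r p) :
    y ∈ coneC r p :=
  ⟨hy.1, by rw [hy.2.1]; exact hy.2.2⟩

/-- Every `W₀ y` with `y` in `simplexBall r p` is close to the convex hull of the columns of a
feasible `W`. -/
lemma exists_close_of_feasible {m n r : ℕ} {p ε : ℝ} {N₀ : Matrix (Fin m) (Fin n) ℝ}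
    {W₀ W : Matrix (Fin m) (Fin r) ℝ} {H₀ H : Matrix (Fin n) (Fin r) ℝ}
    (hH₀ : IsRowStochastic H₀) (hssc : IsPSSC p H₀) (hN : normOneTwo N₀ ≤ ε)
    (hf : IsFeasible (W₀ * H₀ᵀ + N₀) ε W H) {y : Fin r → ℝ} (hy : y ∈ simplexBall r p) :
    ∃ z : Fin r → ℝ, (∀ i, 0 ≤ z i) ∧ ∑ i, z i = 1 ∧ l2 (W₀ *ᵥ y - W *ᵥ z) ≤ 2 * ε := by
  obtain ⟨h, hh, rfl⟩ := hssc (coneC_of_simplexBall hy)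
  have hsum : ∀ K : Matrix (Fin n) (Fin r) ℝ, IsRowStochastic K →
      ∑ i, (Kᵀ *ᵥ h) i = ∑ j, h j := by
    intro K hK
    simp only [mulVec, dotProduct, transpose_apply]
    rw [Finset.sum_comm]
    refine Finset.sum_congr rfl fun j _ => ?_
    rw [← Finset.sum_mul, hK.2, one_mul]
  have hs : ∑ j, h j = 1 := by rw [← hsum H₀ hH₀]; exact hy.2.1
  -- The convex weights `h` that write `y` through the rows of `H₀` are reused with the rows of `H`.
  refine ⟨Hᵀ *ᵥ h, fun i => ?_, by rw [hsum H hf.2, hs], ?_⟩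
  · simp only [mulVec, dotProduct, transpose_apply]
    exact Finset.sum_nonneg fun j _ => mul_nonneg (hf.2.1 j i) (hh j)
  · have e : W₀ *ᵥ (H₀ᵀ *ᵥ h) - W *ᵥ (Hᵀ *ᵥ h) =
        (W₀ * H₀ᵀ + N₀ - W * Hᵀ) *ᵥ h - N₀ *ᵥ h := by
      rw [sub_mulVec, add_mulVec, mulVec_mulVec, mulVec_mulVec]
      abel
    have ha : ∑ j, |h j| = 1 := by
      rw [← hs]; exact Finset.sum_congr rfl fun j _ => abs_of_nonneg (hh j)
    rw [e]
    refine (l2_sub_le _ _).trans ?_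
    have h1 := l2_mulVec_le (W₀ * H₀ᵀ + N₀ - W * Hᵀ) h ε
      fun j => (l2_col_le_normOneTwo _ j).trans hf.1
    have h2 := l2_mulVec_le N₀ h ε fun j => (l2_col_le_normOneTwo _ j).trans hN
    rw [ha] at h1 h2
    linarith

/-- If `W A` is close to `W₀` and `A` is close to a permutation matrix `P`, then `W P` is close to
`W₀`. -/
lemma l2_col_sub_le {m r : ℕ} (W₀ W : Matrix (Fin m) (Fin r) ℝ) (A : Matrix (Fin r) (Fin r) ℝ)
    (π : Equiv.Perm (Fin r)) {φ c τ : ℝ} (hφ : φ ≤ 1 / 2)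
    (hA : ∀ j, ∑ i, |A i j - π.permMatrix ℝ i j| ≤ φ) (hW₀ : ∀ j, l2 (fun i => W₀ i j) ≤ c)
    (hT : ∀ j, l2 (fun i => (W * A - W₀) i j) ≤ τ) (j : Fin r) :
    l2 (fun i => (W₀ - W * π.permMatrix ℝ) i j) ≤ 2 * (φ * c + τ) := by
  have hcol : ∀ j i, (W * π.permMatrix ℝ) i j = W i (π.symm j) := by
    intro j i
    simp [mul_apply, Equiv.Perm.permMatrix, PEquiv.toMatrix_apply, ← Equiv.eq_symm_apply]
  have hne : Nonempty (Fin r) := ⟨j⟩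
  obtain ⟨j₀, hj₀⟩ := Finite.exists_max fun j => l2 (fun i => (W₀ - W * π.permMatrix ℝ) i j)
  set t := l2 (fun i => (W₀ - W * π.permMatrix ℝ) i j₀) with ht
  have hWcol : ∀ k, l2 (fun i => W i k) ≤ c + t := by
    intro k
    have e : (fun i => W i k) =
        (fun i => W₀ i (π k)) - fun i => (W₀ - W * π.permMatrix ℝ) i (π k) := by
      ext i
      simp [hcol]
    rw [e]
    exact (l2_sub_le _ _).trans (add_le_add (hW₀ _) (hj₀ _))
  have e : (fun i => (W₀ - W * π.permMatrix ℝ) i j₀) =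
      W *ᵥ (fun k => A k j₀ - π.permMatrix ℝ k j₀) - fun i => (W * A - W₀) i j₀ := by
    ext i
    simp only [Matrix.sub_apply, mul_apply, mulVec, dotProduct, Pi.sub_apply, mul_sub,
      Finset.sum_sub_distrib]
    ring
  -- The worst column error `t` appears on both sides, and `φ ≤ 1/2` absorbs it.
  have h1 : t ≤ (c + t) * φ + τ := by
    rw [ht]
    conv_lhs => rw [e]
    refine (l2_sub_le _ _).trans (add_le_add ?_ (hT j₀))
    refine (l2_mulVec_le W _ (c + t) hWcol).trans ?_
    exact mul_le_mul_of_nonneg_left (hA j₀) ((l2_nonneg _).trans (hWcol j₀))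
  refine (hj₀ j).trans ?_
  nlinarith [l2_nonneg fun i => (W₀ - W * π.permMatrix ℝ) i j₀]

/-- The robustness estimate with the noise measured relative to the smallest singular value. -/
lemma exists_perm_col_sub_le {m r : ℕ} {p q κ ε : ℝ} (hr : 2 ≤ r)
    (hpr : p ^ 2 ≤ r - 1) (hκ0 : 0 < κ) (hκ : κ ≤ 1 / 2) (hκq : κ ≤ q - 1)
    (hpq : q ^ 2 = r - p ^ 2) (hε : 0 ≤ ε) {W₀ W : Matrix (Fin m) (Fin r) ℝ} (hrank : W₀.rank = r)
    (hvol : vol W ≤ vol W₀)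
    (hεs : 40 * (r ^ 2 * (2 * ε / singularValue W₀ r) / κ) ≤ 1)
    (hclose : ∀ y ∈ simplexBall r p, ∃ z : Fin r → ℝ, (∀ i, 0 ≤ z i) ∧ ∑ i, z i = 1 ∧
      l2 (W₀ *ᵥ y - W *ᵥ z) ≤ 2 * ε) :
    ∃ π : Equiv.Perm (Fin r), ∀ j, l2 (fun i => (W₀ - W * π.permMatrix ℝ) i j) ≤
      48 * spectralNorm W₀ * (r ^ 2 * (2 * ε / singularValue W₀ r) / κ) := by
  have hr1 : 1 ≤ r := by omega
  have hr' : (2 : ℝ) ≤ r := by exact_mod_cast hr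
  set σ := singularValue W₀ r with hσ
  have hσ0 : 0 < σ := singularValue_pos hr1 hrank
  set δ := 2 * ε / σ with hδ
  have hδ0 : 0 ≤ δ := by positivity
  have hεδ : 2 * ε = σ * δ := by rw [hδ]; field_simp
  set ψ := r ^ 2 * δ / κ with hψ
  have hψ0 : 0 ≤ ψ := by positivity
  have hψδ : 2 * (r ^ 2 * δ) ≤ ψ := by
    rw [hψ, le_div_iff₀ hκ0]
    have : 0 ≤ r ^ 2 * δ := by positivity
    nlinarith
  have hrδ : 2 * (r * δ) ≤ r ^ 2 * δ := by
    have : 0 ≤ r * δ := by positivity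
    nlinarith
  have hG := posDef_transpose_mul_self hr1 hrank
  have hGd : 0 < (W₀ᵀ * W₀).det := hG.det_pos
  have hGu : IsUnit (W₀ᵀ * W₀).det := isUnit_iff_ne_zero.2 hGd.ne'
  set B := (W₀ᵀ * W₀)⁻¹ * (W₀ᵀ * W) with hB
  have herr : ∀ y ∈ simplexBall r p, ∃ z : Fin r → ℝ, (∀ i, 0 ≤ z i) ∧ ∑ i, z i = 1 ∧
      l2 (W₀ *ᵥ y - W *ᵥ z) ≤ 2 * ε ∧ l2 (W₀ *ᵥ (y - B *ᵥ z)) ≤ 2 * ε ∧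
      l2 (y - B *ᵥ z) ≤ δ := by
    intro y hy
    obtain ⟨z, hz, hzs, hyz⟩ := hclose y hy
    have e : y - B *ᵥ z = (W₀ᵀ * W₀)⁻¹ *ᵥ (W₀ᵀ *ᵥ (W₀ *ᵥ y - W *ᵥ z)) := by
      rw [mulVec_sub, mulVec_sub, mulVec_mulVec _ W₀ᵀ, mulVec_mulVec _ W₀ᵀ, mulVec_mulVec,
        mulVec_mulVec, nonsing_inv_mul _ hGu, one_mulVec]
    have h1 : l2 (W₀ *ᵥ (y - B *ᵥ z)) ≤ 2 * ε := by
      rw [e]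
      exact (l2_projection_le hGu _).trans hyz
    refine ⟨z, hz, hzs, hyz, h1, ?_⟩
    have h2 := singularValue_mul_l2_le hr1 W₀ (y - B *ᵥ z)
    rw [hδ, le_div_iff₀ hσ0]
    linarith
  -- A left null vector `w` of `B` would satisfy `w ⬝ᵥ y = w ⬝ᵥ (y - B z)`, hence be small on the
  -- slice, giving `‖w‖ ≤ 2r²δ ‖w‖`.
  have hBdet : B.det ≠ 0 := by
    intro h0
    obtain ⟨w, hw0, hw⟩ := exists_vecMul_eq_zero_iff.2 h0
    have h1 : ∀ y ∈ simplexBall r p, |w ⬝ᵥ y| ≤ l2 w * δ := by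
      intro y hy
      obtain ⟨z, -, -, -, -, hyz⟩ := herr y hy
      have : w ⬝ᵥ y = w ⬝ᵥ (y - B *ᵥ z) := by
        rw [dotProduct_sub, dotProduct_mulVec, hw, zero_dotProduct, sub_zero]
      rw [this]
      exact (abs_dot_le _ _).trans (mul_le_mul_of_nonneg_left hyz (l2_nonneg w))
    have h2 := abs_apply_le_of_simplexBall hr hpr w h1
    have h3 : l2 w ≤ r * (2 * r * (l2 w * δ)) := by
      refine (l2_le_sum_abs w).trans ((Finset.sum_le_sum fun j _ => h2 j).trans_eq ?_)
      simp only [Finset.sum_const, Finset.card_univ, Fintype.card_fin, nsmul_eq_mul]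
    have h4 : 0 < l2 w := (l2_nonneg w).lt_of_ne' fun h => hw0 (eq_zero_of_l2_eq_zero h)
    nlinarith
  have hBu : IsUnit B.det := isUnit_iff_ne_zero.2 hBdet
  set A := B⁻¹ with hA
  have hBA : B * A = 1 := mul_nonsing_inv _ hBu
  have hAB : A * B = 1 := nonsing_inv_mul _ hBu
  set T := W * A - W₀ with hT
  have hWA : W * A = W₀ + T := by rw [hT]; abel
  have hWT : W₀ᵀ * T = 0 := by
    have h1 : W₀ᵀ * W = (W₀ᵀ * W₀) * B := by
      rw [hB, ← Matrix.mul_assoc, mul_nonsing_inv _ hGu, Matrix.one_mul]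
    rw [hT, Matrix.mul_sub, ← Matrix.mul_assoc, h1, Matrix.mul_assoc, hBA, Matrix.mul_one, sub_self]
  have hTW : Tᵀ * W₀ = 0 := by
    have := congrArg transpose hWT
    rwa [transpose_mul, transpose_transpose, transpose_zero] at this
  have hdet : 1 ≤ |A.det| := by
    have h1 : (W * A)ᵀ * (W * A) = W₀ᵀ * W₀ + Tᵀ * T := by
      rw [hWA, transpose_add, Matrix.add_mul, Matrix.mul_add, Matrix.mul_add, hWT, hTW]
      abel
    have h2 : ((W * A)ᵀ * (W * A)).det = vol W * A.det ^ 2 := by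
      have : (W * A)ᵀ * (W * A) = Aᵀ * (Wᵀ * W) * A := by
        simp only [transpose_mul, Matrix.mul_assoc]
      rw [this, det_mul, det_mul, det_transpose, vol]
      ring
    have h3 := det_le_det_add_transpose_mul_self hG T
    rw [← h1, h2] at h3
    change vol W ≤ (W₀ᵀ * W₀).det at hvol
    by_contra! hlt
    have h4 : A.det ^ 2 < 1 := by
      rw [← sq_abs]
      nlinarith [abs_nonneg A.det]
    have h5 := sq_nonneg A.det
    nlinarith
  have hAy : ∀ y z : Fin r → ℝ, A *ᵥ y = z + A *ᵥ (y - B *ᵥ z) := by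
    intro y z
    rw [mulVec_sub, mulVec_mulVec, hAB, one_mulVec]
    abel
  have hrow : ∀ y ∈ simplexBall r p, ∀ i, -(δ * l2 (A i)) ≤ A i ⬝ᵥ y := by
    intro y hy i
    obtain ⟨z, hz, -, -, -, hyz⟩ := herr y hy
    have h1 : A i ⬝ᵥ y = z i + A i ⬝ᵥ (y - B *ᵥ z) := congrFun (hAy y z) i
    have h2 := (abs_le.1 (abs_dot_le (A i) (y - B *ᵥ z))).1
    have h3 := mul_le_mul_of_nonneg_left hyz (l2_nonneg (A i))
    rw [h1]
    linarith [hz i]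
  have hcol : ∀ y ∈ simplexBall r p, |(fun j => ∑ i, A i j) ⬝ᵥ y - 1| ≤
      δ * l2 (fun j => ∑ i, A i j) := by
    intro y hy
    obtain ⟨z, -, hzs, -, -, hyz⟩ := herr y hy
    have hw : ∀ x : Fin r → ℝ, (fun j => ∑ i, A i j) ⬝ᵥ x = ∑ i, (A *ᵥ x) i := by
      intro x
      simp only [dotProduct, mulVec, Finset.sum_mul]
      exact Finset.sum_comm
    have h1 : (fun j => ∑ i, A i j) ⬝ᵥ y - 1 = (fun j => ∑ i, A i j) ⬝ᵥ (y - B *ᵥ z) := by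
      rw [hw, hw, hAy y z]
      simp only [Pi.add_apply, Finset.sum_add_distrib, hzs]
      ring
    rw [h1, mul_comm δ]
    exact (abs_dot_le _ _).trans (mul_le_mul_of_nonneg_left hyz (l2_nonneg _))
  obtain ⟨π, hπ⟩ := exists_perm_close hr hpr hκ0 hκ hκq hpq hδ0 (by linarith) A hdet hrow hcol
  -- `T` is bounded on the slice in terms of `ε` and its own largest column `t`; passing to vertices
  -- gives `t ≤ 8rε + 2r²δ t`, and the last term is at most `t/2`.
  have hTcol : ∀ j, l2 (fun i => T i j) ≤ 16 * r * ε := by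
    intro j
    have hne : Nonempty (Fin r) := ⟨j⟩
    obtain ⟨j₀, hj₀⟩ := Finite.exists_max fun j => l2 (fun i => T i j)
    set t := l2 (fun i => T i j₀) with ht
    have ht0 : 0 ≤ t := l2_nonneg _
    have h1 : ∀ y ∈ simplexBall r p, l2 (T *ᵥ y) ≤ 4 * ε + t * (r * δ) := by
      intro y hy
      obtain ⟨z, -, -, hyz, hyW, hyB⟩ := herr y hy
      set e := y - B *ᵥ z with he
      have h2 : T *ᵥ y = T *ᵥ e + (W₀ *ᵥ e - (W₀ *ᵥ y - W *ᵥ z)) := by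
        have h3 : W *ᵥ (A *ᵥ y) = W *ᵥ z + W *ᵥ (A *ᵥ e) := by rw [hAy y z, mulVec_add]
        rw [mulVec_mulVec, mulVec_mulVec, hWA, add_mulVec, add_mulVec] at h3
        have h4 : T *ᵥ y = W *ᵥ z + (W₀ *ᵥ e + T *ᵥ e) - W₀ *ᵥ y := by
          rw [← h3]; abel
        rw [h4]
        abel
      have h5 : l2 (T *ᵥ e) ≤ t * (r * δ) := by
        refine (l2_mulVec_le T e t hj₀).trans (mul_le_mul_of_nonneg_left ?_ ht0)
        refine (Finset.sum_le_sum fun j _ => (abs_apply_le_l2 e j).trans hyB).trans_eq ?_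
        simp only [Finset.sum_const, Finset.card_univ, Fintype.card_fin, nsmul_eq_mul]
      rw [h2]
      refine (l2_add_le _ _).trans ?_
      have h6 := l2_sub_le (W₀ *ᵥ e) (W₀ *ᵥ y - W *ᵥ z)
      linarith
    have h2 := l2_col_le_of_simplexBall hr hpr T h1 j₀
    have h3 : t * (2 * (r ^ 2 * δ)) ≤ t * (1 / 2) := mul_le_mul_of_nonneg_left (by linarith) ht0
    have h4 : 2 * r * (4 * ε + t * (r * δ)) = 8 * r * ε + t * (2 * (r ^ 2 * δ)) := by ring
    rw [h4, ← ht] at h2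
    refine (hj₀ j).trans ?_
    change t ≤ _
    linarith
  refine ⟨π, fun j => ?_⟩
  refine (l2_col_sub_le W₀ W A π (by linarith) hπ
    (l2_col_le_spectralNorm W₀) hTcol j).trans ?_
  have hσS : σ ≤ spectralNorm W₀ := by
    have h1 := singularValue_mul_l2_le hr1 W₀ (Pi.single j 1)
    have h2 := l2_mulVec_le_spectralNorm W₀ (Pi.single j 1)
    rw [l2_single, mul_one] at h1 h2
    exact h1.trans h2
  have h1 : 16 * r * ε ≤ spectralNorm W₀ * (2 * ψ) := by
    calc 16 * r * ε = σ * (8 * (r * δ)) := by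
          have : 16 * r * ε = 8 * r * (2 * ε) := by ring
          rw [this, hεδ]; ring
      _ ≤ σ * (2 * ψ) := mul_le_mul_of_nonneg_left (by linarith) hσ0.le
      _ ≤ _ := mul_le_mul_of_nonneg_right hσS (by positivity)
  have h2 : 0 ≤ spectralNorm W₀ * ψ := mul_nonneg (norm_nonneg _) hψ0
  linarith

/-! ### Scalar estimates and the theorem -/

lemma min_sq_sub_one_le {q : ℝ} (hq : 1 < q) :
    min (q ^ 2 - 1) 1 ≤ 3 * (min q (Real.sqrt 2) - 1) := by
  have h3 : 1.4 ≤ Real.sqrt 2 := Real.le_sqrt_of_sq_le (by norm_num)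
  rcases le_total q (Real.sqrt 2) with h | h
  · rw [min_eq_left h]
    refine (min_le_left _ _).trans ?_
    have h4 : Real.sqrt 2 ≤ 2 := Real.sqrt_le_iff.2 ⟨by norm_num, by norm_num⟩
    nlinarith [mul_nonneg (sub_nonneg.2 hq.le) (sub_nonneg.2 (h.trans h4))]
  · rw [min_eq_right h]
    refine (min_le_right _ _).trans ?_
    linarith

lemma normOneTwo_le {m n : ℕ} {A : Matrix (Fin m) (Fin n) ℝ} [Nonempty (Fin n)] {c : ℝ}
    (h : ∀ j, l2 (fun i => A i j) ≤ c) : normOneTwo A ≤ c :=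
  ciSup_le h

/-- The quadratic decay in `δ` of the linear estimate absorbs it into the square root. -/
lemma sq_le_of_small {u κ ρ δ M x : ℝ} (hu : 1 ≤ u) (hκ0 : 0 < κ) (hκ : κ ≤ 1 / 2) (hρ : 0 < ρ)
    (hρu : ρ ≤ u ^ 2) (hδ0 : 0 ≤ δ) (hδ : δ ≤ κ ^ 2 * ρ / (50 * u ^ 9)) (hM0 : 0 < M)
    (hM : M ≤ 3 * κ) (hx : x = δ * u ^ 7 / (2 * M * ρ)) :
    (u ^ 4 * δ / κ) ^ 2 ≤ 400 * x := by
  have hu0 : 0 < u := by linarith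
  -- Only one of the two factors `δ` is replaced by its upper bound; the other remains as the `ε`
  -- under the root.
  have h1 : (u ^ 4 * δ / κ) ^ 2 ≤ δ * ρ / (50 * u) := by
    calc (u ^ 4 * δ / κ) ^ 2 = u ^ 8 * δ / κ ^ 2 * δ := by ring
      _ ≤ u ^ 8 * δ / κ ^ 2 * (κ ^ 2 * ρ / (50 * u ^ 9)) :=
        mul_le_mul_of_nonneg_left hδ (by positivity)
      _ = _ := by field_simp
  have h2 : δ * ρ / (50 * u) ≤ 400 * x := by
    rw [hx, mul_div_assoc', div_le_div_iff₀ (by positivity) (by positivity)]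
    have h3 : ρ ^ 2 ≤ u ^ 8 := by
      calc ρ ^ 2 ≤ (u ^ 2) ^ 2 := by gcongr
        _ = u ^ 4 := by ring
        _ ≤ u ^ 8 := pow_le_pow_right₀ hu (by norm_num)
    have h4 : M * ρ ^ 2 ≤ 3 / 2 * u ^ 8 :=
      mul_le_mul (by linarith) h3 (by positivity) (by norm_num)
    have h5 := mul_le_mul_of_nonneg_left h4 hδ0
    have h6 : 0 ≤ δ * u ^ 8 := by positivity
    nlinarith
  exact h1.trans h2

lemma small_of_small {u κ ρ δ : ℝ} (hu : 1 ≤ u) (hκ0 : 0 < κ) (hκ : κ ≤ 1 / 2)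
    (hρu : ρ ≤ u ^ 2) (hδ : δ ≤ κ ^ 2 * ρ / (50 * u ^ 9)) :
    40 * (u ^ 4 * δ / κ) ≤ 1 := by
  have hu0 : 0 < u := by linarith
  have h1 : δ ≤ κ ^ 2 / (50 * u ^ 7) := by
    refine hδ.trans ?_
    rw [div_le_div_iff₀ (by positivity) (by positivity)]
    have : κ ^ 2 * (50 * u ^ 7) * ρ ≤ κ ^ 2 * (50 * u ^ 7) * u ^ 2 :=
      mul_le_mul_of_nonneg_left hρu (by positivity)
    nlinarith
  rw [le_div_iff₀ (by positivity)] at h1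
  rw [mul_div_assoc', div_le_one hκ0]
  have h2 : (1 : ℝ) ≤ u ^ 3 := one_le_pow₀ hu
  have h3 : 50 * (u ^ 4 * δ) * u ^ 3 ≤ κ * u ^ 3 := by nlinarith
  have h4 := le_of_mul_le_mul_right h3 (by positivity)
  linarith

end MinVolNMF

theorem theorem1 :
    ∃ Cε Ce : ℝ, 0 < Cε ∧ 0 < Ce ∧
      ∀ (m n r : ℕ) (p q ε : ℝ)
        (X N₀ : Matrix (Fin m) (Fin n) ℝ)
        (W₀ : Matrix (Fin m) (Fin r) ℝ) (H₀ : Matrix (Fin n) (Fin r) ℝ),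
        2 ≤ r →
        1 ≤ p →
        (2 < r → p < Real.sqrt ((r : ℝ) - 1)) →
        (r = 2 → p = 1) →
        q = Real.sqrt ((r : ℝ) - p ^ 2) →
        0 < ε →
        X = W₀ * H₀.transpose + N₀ →
        MinVolNMF.IsRowStochastic H₀ →
        MinVolNMF.IsPSSC p H₀ →
        W₀.rank = r →
        MinVolNMF.normOneTwo N₀ ≤ ε →
        ε ≤ Cε * (min q (Real.sqrt 2) - 1) ^ 2 *
            (MinVolNMF.singularValue W₀ r / (r : ℝ) ^ (9 / 2 : ℝ)) * (q ^ 2 / p ^ 2) →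
        ∀ (W : Matrix (Fin m) (Fin r) ℝ) (H : Matrix (Fin n) (Fin r) ℝ),
          MinVolNMF.IsOptimal X ε W H →
          (⨅ π : Equiv.Perm (Fin r), MinVolNMF.normOneTwo (W₀ - W * π.permMatrix ℝ)) ≤
            Ce * MinVolNMF.spectralNorm W₀ *
              Real.sqrt (ε / min (q ^ 2 - 1) 1 *
                ((r : ℝ) ^ (7 / 2 : ℝ) / MinVolNMF.singularValue W₀ r) * (p ^ 2 / q ^ 2)) := by
  open MinVolNMF in
  refine ⟨1 / 100, 1000, by norm_num, by norm_num, ?_⟩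
  intro m n r p q ε X N₀ W₀ H₀ hr hp hpr hpr2 hq hε hX hH₀ hssc hrank hN hsmall W H hopt
  have hr' : (2 : ℝ) ≤ r := by exact_mod_cast hr
  -- For `r = 2`, `q = 1` makes the bound on `ε` zero, contradicting `0 < ε`.
  rcases hr.eq_or_lt with rfl | hr3
  · have hq1 : q = 1 := by rw [hq, hpr2 rfl]; norm_num
    have : min q (Real.sqrt 2) = 1 := by
      rw [hq1, min_eq_left]
      exact Real.le_sqrt_of_sq_le (by norm_num)
    rw [this] at hsmall
    norm_num at hsmall
    linarith
  have hplt : p ^ 2 < r - 1 := (Real.lt_sqrt (by linarith)).1 (hpr hr3)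
  have hpq : q ^ 2 = r - p ^ 2 := by rw [hq, Real.sq_sqrt (by linarith)]
  have hq1 : 1 < q := by
    rw [hq]
    exact Real.lt_sqrt_of_sq_lt (by linarith)
  set κ := min q (Real.sqrt 2) - 1 with hκdef
  have hs2 : Real.sqrt 2 ≤ 1.5 := Real.sqrt_le_iff.2 ⟨by norm_num, by norm_num⟩
  have hs1 : 1 < Real.sqrt 2 := Real.lt_sqrt_of_sq_lt (by norm_num)
  have hκ0 : 0 < κ := sub_pos.2 (lt_min hq1 hs1)
  have hκq : κ ≤ q - 1 := sub_le_sub_right (min_le_left _ _) 1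
  have hκ : κ ≤ 1 / 2 := by
    have := min_le_right q (Real.sqrt 2)
    linarith
  set σ := singularValue W₀ r
  have hσ0 : 0 < σ := singularValue_pos (by omega) hrank
  -- With `u = √r`, the half-integer powers of `r` become natural powers.
  obtain ⟨u, hu0, hur⟩ : ∃ u : ℝ, 0 < u ∧ (r : ℝ) = u ^ 2 :=
    ⟨Real.sqrt r, Real.sqrt_pos.2 (by linarith), (Real.sq_sqrt (by linarith)).symm⟩
  have hu1 : 1 ≤ u := by nlinarith
  have hpow : ∀ k : ℕ, (r : ℝ) ^ ((k : ℝ) / 2) = u ^ k := by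
    intro k
    rw [hur, ← Real.rpow_natCast u 2, ← Real.rpow_mul hu0.le, ← Real.rpow_natCast u k]
    congr 1
    push_cast
    ring
  have h9 : (r : ℝ) ^ (9 / 2 : ℝ) = u ^ 9 := by exact_mod_cast hpow 9
  have h7 : (r : ℝ) ^ (7 / 2 : ℝ) = u ^ 7 := by exact_mod_cast hpow 7
  rw [h9] at hsmall
  rw [h7]
  have hp0 : 0 < p := by linarith
  have hq0 : 0 < q := by linarith
  set ρ := q ^ 2 / p ^ 2 with hρdef
  have hρ0 : 0 < ρ := by positivity
  have hρu : ρ ≤ u ^ 2 := by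
    rw [hρdef, div_le_iff₀ (by positivity), hpq, hur]
    have h1 : 1 ≤ p ^ 2 := one_le_pow₀ hp
    nlinarith [sq_nonneg u]
  set δ := 2 * ε / σ with hδdef
  have hδ0 : 0 ≤ δ := by positivity
  have hδ : δ ≤ κ ^ 2 * ρ / (50 * u ^ 9) := by
    rw [hδdef, div_le_iff₀ hσ0]
    have : κ ^ 2 * ρ / (50 * u ^ 9) * σ = 2 * (1 / 100 * κ ^ 2 * (σ / u ^ 9) * ρ) := by
      field_simp
      norm_num
    rw [this]
    linarith
  have hr4 : (r : ℝ) ^ 2 = u ^ 4 := by rw [hur]; ring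
  -- Optimality is used only against this competitor, to get `vol W ≤ vol W₀`.
  have hfeas₀ : IsFeasible X ε W₀ H₀ := by
    refine ⟨?_, hH₀⟩
    rw [hX, add_sub_cancel_left]
    exact hN
  obtain ⟨π, hπ⟩ := exists_perm_col_sub_le hr hplt.le hκ0 hκ hκq hpq hε.le hrank
    (hopt.2 W₀ H₀ hfeas₀) (by rw [hr4]; exact small_of_small hu1 hκ0 hκ hρu hδ)
    (fun y hy => exists_close_of_feasible hH₀ hssc hN (hX ▸ hopt.1) hy)
  have hne : Nonempty (Fin r) := ⟨⟨0, by omega⟩⟩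
  refine (ciInf_le (Set.finite_range _).bddBelow π).trans ((normOneTwo_le hπ).trans ?_)
  change 48 * spectralNorm W₀ * (r ^ 2 * δ / κ) ≤ _
  rw [hr4]
  set M := min (q ^ 2 - 1) 1 with hMdef
  have hM0 : 0 < M := lt_min (by nlinarith) one_pos
  have hsq := sq_le_of_small hu1 hκ0 hκ hρ0 hρu hδ0 hδ hM0 (min_sq_sub_one_le hq1)
    (x := ε / M * (u ^ 7 / σ) * (p ^ 2 / q ^ 2)) (by
      rw [hδdef, hρdef]
      field_simp)
  have hle : u ^ 4 * δ / κ ≤ 20 * Real.sqrt (ε / M * (u ^ 7 / σ) * (p ^ 2 / q ^ 2)) := by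
    have h1 := Real.le_sqrt_of_sq_le hsq
    rw [Real.sqrt_mul (by norm_num)] at h1
    have h2 : Real.sqrt 400 = 20 := by
      rw [show (400 : ℝ) = 20 ^ 2 by norm_num, Real.sqrt_sq (by norm_num)]
    rwa [h2] at h1
  have hS : 0 ≤ spectralNorm W₀ := norm_nonneg _
  have h1 := mul_le_mul_of_nonneg_left hle hS
  have h2 : 0 ≤ spectralNorm W₀ * Real.sqrt (ε / M * (u ^ 7 / σ) * (p ^ 2 / q ^ 2)) :=
    mul_nonneg hS (Real.sqrt_nonneg _)
  -- The constants combine to `48 · 20 = 960 ≤ 1000`.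
  linarith
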